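/- **Theorem 3.1.** Let $X$ be a connected, locally path-connected topological space and let $f\colon X\to\mathbb{R}$ be a continuous function. Let $R_f=X/{\sim}$ be the Reeb graph of $f$, where $x\sim y$ if and only if $x$ and $y$ lie in the same connected component of the same level set of $f$, with the quotient topology. Suppose that $R_f$ is a finite topological graph, i.e. is homeomorphic to the geometric realization of a graph with finitely many vertices and edges (loops and multiple edges allowed). Then the cycle rank of $R_f$, i.e. its first Betti number $b_1(R_f)=\operatorname{rank} H_1(R_f;\mathbb{Z})$, satisfies $$b_1(R_f)\le b_1'(X),\qquad b_1'(X)=\operatorname{corank}(\pi_1(X)),$$ where the co-rank of a group $G$ is the supremum (as a cardinal) of the ranks of the free groups that are homomorphic images of $G$; it is a maximum when $G$ is finitely generated. -/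

import Mathlib

universe u

noncomputable section

/-- Two points are equivalent for `f` if they lie in the same contour of `f`, that is, in the same
connected component of the same level set. -/
def contourSetoid {X : Type*} [TopologicalSpace X] (f : X → ℝ) : Setoid X where
  r x y := y ∈ connectedComponentIn (f ⁻¹' {f x}) x
  iseqv :=
    { refl := fun x => mem_connectedComponentIn (by simp)
      symm := by
        intro x y h
        have hxy : f y = f x := by simpa using connectedComponentIn_subset _ _ h
        rw [hxy, ← connectedComponentIn_eq h]
        exact mem_connectedComponentIn (by simp)
      trans := by
        intro x y z h h'
        have hxy : f y = f x := by simpa using connectedComponentIn_subset _ _ h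
        rw [hxy, ← connectedComponentIn_eq h] at h'
        exact h' }

/-- The Reeb graph of `f`: the set of contours of `f`. -/
def ReebGraph {X : Type*} [TopologicalSpace X] (f : X → ℝ) : Type _ :=
  Quotient (contourSetoid f)

/-- The Reeb graph carries the quotient topology. -/
instance {X : Type*} [TopologicalSpace X] (f : X → ℝ) : TopologicalSpace (ReebGraph f) :=
  inferInstanceAs (TopologicalSpace (Quotient (contourSetoid f)))

/-- The end-point identifications of a finite graph with vertices `Fin m` and edges `Fin n`, in
which the edge `e` runs from the vertex `src e` to the vertex `tgt e`: the point `0` of the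
interval of `e` is glued to `src e`, and the point `1` to `tgt e`. Loops and multiple edges are
allowed. -/
inductive EndpointRel {m n : ℕ} (src tgt : Fin n → Fin m) :
    Fin m ⊕ (Fin n × unitInterval) → Fin m ⊕ (Fin n × unitInterval) → Prop
  | src (e : Fin n) : EndpointRel src tgt (Sum.inr (e, 0)) (Sum.inl (src e))
  | tgt (e : Fin n) : EndpointRel src tgt (Sum.inr (e, 1)) (Sum.inl (tgt e))

/-- The geometric realization of a finite graph: the quotient space of the disjoint union of the
finite discrete set of vertices and one closed unit interval for each edge. -/
abbrev GraphRealization {m n : ℕ} (src tgt : Fin n → Fin m) : Type :=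
  Quot (EndpointRel src tgt)

/-- A finite topological graph: a space homeomorphic to the geometric realization of a finite
graph. -/
def IsFiniteTopologicalGraph (Y : Type*) [TopologicalSpace Y] : Prop :=
  ∃ (m n : ℕ) (src tgt : Fin n → Fin m), Nonempty (Y ≃ₜ GraphRealization src tgt)

/-- The first singular homology group of `Y` with integer coefficients. -/
abbrev singularH1 (Y : Type u) [TopologicalSpace Y] : ModuleCat.{u} ℤ :=
  ((AlgebraicTopology.singularHomologyFunctor.{u} (ModuleCat.{u} ℤ) 1).obj
    (ModuleCat.of ℤ (ULift.{u} ℤ))).obj (TopCat.of Y)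

/-- The first Betti number: the rank of the first integral homology group, as a cardinal. -/
def firstBettiNumber (Y : Type u) [TopologicalSpace Y] : Cardinal.{u} :=
  Module.rank ℤ (singularH1 Y)

/-- The ranks of the free groups that are homomorphic images of `G`. -/
def freeImageRanks (G : Type u) [Group G] : Set Cardinal.{u} :=
  {c | ∃ (S : Type u) (φ : G →* FreeGroup S), Function.Surjective φ ∧ Cardinal.mk S = c}

/-- The supremum in `corank` is over a bounded set. -/
theorem bddAbove_freeImageRanks (G : Type u) [Group G] : BddAbove (freeImageRanks G) := by
  refine ⟨Cardinal.mk G, ?_⟩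
  rintro c ⟨S, φ, hφ, rfl⟩
  exact (Cardinal.mk_le_of_injective FreeGroup.of_injective).trans
    (Cardinal.mk_le_of_surjective hφ)

/-- The co-rank of a group: the largest rank of a free homomorphic image, as a cardinal. It is a
maximum if `G` is finitely generated, and a supremum in general. -/
def corank (G : Type u) [Group G] : Cardinal.{u} :=
  sSup (freeImageRanks G)

end

/-! Both sides are compared with the number `k` of edges of the graph `R_f` lying outside a spanning
tree `T`.

Upper bound `b₁(R_f) ≤ k`. Work with singular 1-chains modulo boundaries, a group containing `H₁`.
Vertex labels can be chosen so that each edge of `T` is the difference of the labels of its ends;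
each other edge then has a defect. After dividing by the subgroup generated by the `k` defects, the
labels extend to a potential on the whole graph. Every path becomes the difference of the potential
at its ends, because this holds locally, where the graph contracts to a point. Cycles therefore die
in the quotient, so `H₁` lies in a group with `k` generators (`firstBettiNumber_le_card_compl`). The
reverse inequality is not needed.

Lower bound `k ≤ corank π₁(X)`. The fibres of `X → R_f` are contours, hence connected. A quotient
map with connected fibres pulls connected open sets back to connected sets, and in a locally
path-connected space these are path-connected. So the graph cut at the mid-points of the `k` edges,
together with the interiors of these edges, pulls back to a path-connected core joined to itself by
`k` path-connected bridges (`graphBridgeCover`). Gluing copies of the pieces, with one free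
generator per bridge, gives a path-connected covering of `X` with fibre the free group. Its
monodromy maps `π₁(X)` onto that group (`BridgeCover.exists_surjective`). -/

noncomputable section

/-! ### Singular 1-chains modulo boundaries, and classes of segments. -/

open CategoryTheory Simplicial Topology

/-- The integral singular chain complex of `Y`. -/
abbrev integralChains (Y : Type u) [TopologicalSpace Y] : ChainComplex (ModuleCat.{u} ℤ) ℕ :=
  (TopCat.toSSet.obj (TopCat.of Y)).chainComplex (ModuleCat.of ℤ (ULift.{u} ℤ))

/-- The class of a singular simplex in the quotient of the chains by the boundaries. -/
def simplexClass {Y : Type u} [TopologicalSpace Y] {n : ℕ}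
    (σ : (TopCat.toSSet.obj (TopCat.of Y)) _⦋n⦌) : (integralChains Y).opcycles n :=
  (SSet.ιChainComplex (R := ModuleCat.of ℤ (ULift.{u} ℤ)) _ σ ≫
    (integralChains Y).pOpcycles n) (ULift.up 1)

theorem simplexClass_boundary {Y : Type u} [TopologicalSpace Y]
    (τ : (TopCat.toSSet.obj (TopCat.of Y)) _⦋2⦌) :
    simplexClass (SimplicialObject.δ (TopCat.toSSet.obj (TopCat.of Y)) 0 τ)
      - simplexClass (SimplicialObject.δ (TopCat.toSSet.obj (TopCat.of Y)) 1 τ)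
      + simplexClass (SimplicialObject.δ (TopCat.toSSet.obj (TopCat.of Y)) 2 τ) = 0 := by
  have h := SSet.ιChainComplex_d _ (ModuleCat.of ℤ (ULift.{u} ℤ)) τ
  have h2 := congrArg (fun f => (f ≫ (integralChains Y).pOpcycles 1) (ULift.up 1)) h
  simp only [Category.assoc, HomologicalComplex.d_pOpcycles, Limits.comp_zero] at h2
  rw [Fin.sum_univ_three] at h2
  simp only [Preadditive.add_comp, Preadditive.zsmul_comp] at h2
  have h3 : (0 : (integralChains Y).opcycles 1) = _ := h2
  rw [h3]
  simp [simplexClass, sub_eq_add_neg]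

/-- If, after applying a homomorphism `q` on the one-chains modulo boundaries, every singular
one-simplex becomes the difference of a potential at its end-points, and the kernel of `q` is
generated by `k` elements, then the first Betti number is at most `k`. -/
theorem firstBettiNumber_le_of_potential {Y : Type u} [TopologicalSpace Y]
    {N : Type u} [AddCommGroup N] (q : (integralChains Y).opcycles 1 →+ N)
    (α : (TopCat.toSSet.obj (TopCat.of Y)) _⦋0⦌ → N)
    (h : ∀ σ : (TopCat.toSSet.obj (TopCat.of Y)) _⦋1⦌,
      q (simplexClass σ) = α (SimplicialObject.δ (TopCat.toSSet.obj (TopCat.of Y)) 0 σ)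
        - α (SimplicialObject.δ (TopCat.toSSet.obj (TopCat.of Y)) 1 σ))
    {κ : Type} [Fintype κ] (w : κ → (integralChains Y).opcycles 1)
    (hw : ∀ x, q x = 0 → x ∈ AddSubgroup.closure (Set.range w)) :
    firstBettiNumber Y ≤ Fintype.card κ := by
  let K := integralChains Y
  let S := TopCat.toSSet.obj (TopCat.of Y)
  let M : ModuleCat.{u} ℤ := ModuleCat.of ℤ N
  let q' : K.opcycles 1 ⟶ M := ModuleCat.ofHom
    { toFun := q, map_add' := map_add q, map_smul' := fun n x => map_intCast_smul q ℤ ℤ n x }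
  let A : K.X 0 ⟶ M := Limits.Cofan.IsColimit.desc (S.isColimitChainComplexXCofan _ 0)
    (fun v => ModuleCat.ofHom ((LinearMap.toSpanSingleton ℤ N (α v)).comp
      ULift.moduleEquiv.toLinearMap))
  have hA : ∀ v : S _⦋0⦌, (S.ιChainComplex v ≫ A) (ULift.up 1) = α v := by
    intro v
    have : S.ιChainComplex v ≫ A = _ :=
      Limits.Cofan.IsColimit.fac (S.isColimitChainComplexXCofan _ 0) _ v
    rw [this]
    simp
  -- On chains, `q` is the boundary map followed by the linear extension `A` of `α`, so it vanishes
  -- on cycles.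
  have key : K.pOpcycles 1 ≫ q' = K.d 1 0 ≫ A := by
    refine SSet.chainComplex_hom_ext fun σ => ?_
    have e1 : S.ιChainComplex σ ≫ K.d 1 0 ≫ A = _ :=
      congrArg (fun f => f ≫ A) (SSet.ιChainComplex_d _ (ModuleCat.of ℤ (ULift.{u} ℤ)) σ)
    rw [e1]
    have e2 : (S.ιChainComplex σ ≫ K.pOpcycles 1 ≫ q') (ULift.up 1) =
        ((∑ i : Fin 2, (-1 : ℤ) ^ i.val • S.ιChainComplex (SimplicialObject.δ S i σ)) ≫ A)
          (ULift.up 1) := by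
      rw [Fin.sum_univ_two, Preadditive.add_comp, Preadditive.zsmul_comp, Preadditive.zsmul_comp]
      have h0 := hA (SimplicialObject.δ S 0 σ)
      have h1 := hA (SimplicialObject.δ S 1 σ)
      refine (h σ).trans ?_
      rw [← h0, ← h1]
      simp [sub_eq_add_neg]
    ext x
    obtain ⟨n⟩ := x
    have hn : (ULift.up n : ULift.{u} ℤ) = n • ULift.up 1 := by
      ext; simp
    have e3 := congrArg (fun z => n • z) e2
    simp only [← map_zsmul, ← hn] at e3
    exact e3
  -- Homology embeds in the chains modulo boundaries; its image consists of classes of cycles, hence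
  -- lies in the kernel of `q` and so in the span of `w`.
  let ι := (K.homologyι 1).hom
  have hι : Function.Injective ι := (ModuleCat.mono_iff_injective _).1 inferInstance
  let Z : Submodule ℤ (K.opcycles 1) := Submodule.span ℤ (Set.range w)
  have hZ : ∀ x, ι x ∈ Z := by
    intro x
    obtain ⟨c, rfl⟩ := (ModuleCat.epi_iff_surjective (K.homologyπ 1)).1 inferInstance x
    have e : K.homologyπ 1 ≫ K.homologyι 1 ≫ q' = 0 := by
      rw [HomologicalComplex.homology_π_ι_assoc, key, HomologicalComplex.iCycles_d_assoc,
        Limits.zero_comp]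
    have := congrArg (fun f => f c) e
    exact (AddSubgroup.closure_le Z.toAddSubgroup).2 Submodule.subset_span (hw _ this)
  let : Module ℤ Z := Z.module
  have r1 : Module.rank ℤ (K.homology 1) ≤ Module.rank ℤ Z :=
    LinearMap.rank_le_of_injective (ι.codRestrict Z hZ)
      (fun x y hxy => hι (congrArg Subtype.val hxy))
  have r2 : Module.rank ℤ Z ≤ Fintype.card κ := by
    refine (rank_span_le _).trans ?_
    have := Cardinal.mk_range_le_lift (f := w)
    simpa using this
  exact r1.trans r2

/-- The singular simplex of the affine simplex with vertices `a`, composed with `φ`. -/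
def affineSimplex {Y : Type u} [TopologicalSpace Y] {E : Type*} [AddCommGroup E] [Module ℝ E]
    [TopologicalSpace E] [ContinuousAdd E] [ContinuousSMul ℝ E] (φ : C(E, Y)) {n : ℕ}
    (a : Fin (n + 1) → E) : (TopCat.toSSet.obj (TopCat.of Y)) _⦋n⦌ :=
  (TopCat.toSSetObjEquiv (TopCat.of Y) (.op ⦋n⦌)).symm
    ⟨fun x : stdSimplex ℝ (Fin (n + 1)) => φ (∑ i, x i • a i), by
      refine φ.continuous.comp (continuous_finsetSum _ fun i _ => Continuous.smul ?_ continuous_const)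
      exact (continuous_apply i).comp continuous_subtype_val⟩

theorem δ_affineSimplex {Y : Type u} [TopologicalSpace Y] {E : Type*} [AddCommGroup E] [Module ℝ E]
    [TopologicalSpace E] [ContinuousAdd E] [ContinuousSMul ℝ E] (φ : C(E, Y)) {n : ℕ}
    (a : Fin (n + 2) → E) (i : Fin (n + 2)) :
    SimplicialObject.δ (TopCat.toSSet.obj (TopCat.of Y)) i (affineSimplex φ a) =
      affineSimplex φ (a ∘ i.succAbove) := by
  apply (TopCat.toSSetObjEquiv (TopCat.of Y) (.op ⦋n⦌)).injective
  rw [affineSimplex, affineSimplex, Equiv.apply_symm_apply]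
  ext x
  change φ (∑ j, (FunOnFinite.linearMap ℝ ℝ i.succAbove x) j • a j) = φ (∑ j, x j • a (i.succAbove j))
  congr 1
  simp only [FunOnFinite.linearMap_apply_apply, Finset.sum_smul]
  rw [Finset.sum_congr rfl (fun j _ => Finset.sum_congr rfl (g := fun k => x k • a (i.succAbove k))
    (fun k hk => by rw [(Finset.mem_filter.1 hk).2]))]
  exact Finset.sum_fiberwise Finset.univ i.succAbove (fun k => x k • a (i.succAbove k))

/-- The class, modulo boundaries, of the image under `φ` of the segment from `a` to `b`. -/
def segmentClass {Y : Type u} [TopologicalSpace Y] {E : Type*} [AddCommGroup E] [Module ℝ E]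
    [TopologicalSpace E] [ContinuousAdd E] [ContinuousSMul ℝ E] (φ : C(E, Y)) (a b : E) :
    (integralChains Y).opcycles 1 :=
  simplexClass (affineSimplex φ ![a, b])

section

variable {Y : Type u} [TopologicalSpace Y] {E E' : Type*} [AddCommGroup E] [Module ℝ E]
  [TopologicalSpace E] [ContinuousAdd E] [ContinuousSMul ℝ E] [AddCommGroup E'] [Module ℝ E']
  [TopologicalSpace E'] [ContinuousAdd E'] [ContinuousSMul ℝ E']

/-- The three segments are the faces of the affine triangle on `a`, `b`, `c`, whose boundary is zero
in the quotient. -/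
theorem segmentClass_add (φ : C(E, Y)) (a b c : E) :
    segmentClass φ a b + segmentClass φ b c = segmentClass φ a c := by
  have h := simplexClass_boundary (affineSimplex φ ![a, b, c])
  rw [δ_affineSimplex, δ_affineSimplex, δ_affineSimplex] at h
  have e0 : ![a, b, c] ∘ (0 : Fin 3).succAbove = ![b, c] := by ext i; fin_cases i <;> rfl
  have e1 : ![a, b, c] ∘ (1 : Fin 3).succAbove = ![a, c] := by ext i; fin_cases i <;> rfl
  have e2 : ![a, b, c] ∘ (2 : Fin 3).succAbove = ![a, b] := by ext i; fin_cases i <;> rfl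
  rw [e0, e1, e2] at h
  change segmentClass φ b c - segmentClass φ a c + segmentClass φ a b = 0 at h
  rw [← sub_eq_zero, ← h]
  abel

theorem segmentClass_self (φ : C(E, Y)) (a : E) : segmentClass φ a a = 0 := by
  simpa using segmentClass_add φ a a a

theorem segmentClass_symm (φ : C(E, Y)) (a b : E) :
    segmentClass φ b a = - segmentClass φ a b := by
  rw [eq_neg_iff_add_eq_zero, segmentClass_add, segmentClass_self]

theorem segmentClass_congr {φ : C(E, Y)} {ψ : C(E', Y)} {a b : E} {a' b' : E'}
    (h : ∀ t ∈ Set.Icc (0 : ℝ) 1,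
      φ ((1 - t) • a + t • b) = ψ ((1 - t) • a' + t • b')) :
    segmentClass φ a b = segmentClass ψ a' b' := by
  unfold segmentClass
  congr 1
  refine congrArg (TopCat.toSSetObjEquiv (TopCat.of Y) (.op ⦋1⦌)).symm ?_
  ext x
  change φ (∑ j : Fin 2, x j • ![a, b] j) = ψ (∑ j : Fin 2, x j • ![a', b'] j)
  have h1 : x 0 + x 1 = 1 := by
    have := x.2.2
    rwa [Fin.sum_univ_two] at this
  have h0 : x 0 = 1 - x 1 := by linarith
  have hx0 : 0 ≤ x 0 := x.2.1 0
  have hx1 : 0 ≤ x 1 := x.2.1 1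
  simp only [Fin.sum_univ_two, Matrix.cons_val_zero, Matrix.cons_val_one, h0]
  exact h _ ⟨hx1, by linarith⟩

theorem segmentClass_eq_zero {φ : C(E, Y)} {a b : E} {y : Y}
    (h : ∀ t ∈ Set.Icc (0 : ℝ) 1, φ ((1 - t) • a + t • b) = y) : segmentClass φ a b = 0 := by
  rw [← segmentClass_self φ a]
  refine segmentClass_congr fun t ht => ?_
  rw [h t ht, ← add_smul, sub_add_cancel, one_smul]
  simpa using (h 0 (by simp)).symm

/-- Clamping the parameter to the unit interval extends a path to all of `ℝ`, so segment classes
account for every singular 1-simplex. -/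
theorem exists_affineSimplex (σ : (TopCat.toSSet.obj (TopCat.of Y)) _⦋1⦌) :
    ∃ φ : C(ℝ, Y), σ = affineSimplex φ ![0, 1] := by
  let g := TopCat.toSSetObjEquiv (TopCat.of Y) (.op ⦋1⦌) σ
  let p : C(ℝ, stdSimplex ℝ (Fin 2)) :=
    ⟨fun t => ⟨![1 - (Set.projIcc (0 : ℝ) 1 zero_le_one t : ℝ), Set.projIcc (0 : ℝ) 1 zero_le_one t],
      by
        have := (Set.projIcc (0 : ℝ) 1 zero_le_one t).2
        refine ⟨fun i => ?_, by simp⟩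
        fin_cases i
        · simpa using this.2
        · simpa using this.1⟩, by
      refine Continuous.subtype_mk (continuous_pi fun i => ?_) _
      have := continuous_subtype_val.comp (continuous_projIcc (α := ℝ) (h := zero_le_one))
      fin_cases i
      · exact continuous_const.sub this
      · exact this⟩
  refine ⟨⟨fun t => g (p t), g.continuous.comp p.continuous⟩, ?_⟩
  refine (Equiv.symm_apply_apply (TopCat.toSSetObjEquiv (TopCat.of Y) (.op ⦋1⦌)) σ).symm.trans ?_
  refine congrArg (TopCat.toSSetObjEquiv (TopCat.of Y) (.op ⦋1⦌)).symm ?_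
  ext x
  change g x = g (p (∑ j : Fin 2, x j • ![(0 : ℝ), 1] j))
  congr 1
  have h1 : x 0 + x 1 = 1 := by
    have := x.2.2
    rwa [Fin.sum_univ_two] at this
  have hx0 : 0 ≤ x 0 := x.2.1 0
  have hx1 : 0 ≤ x 1 := x.2.1 1
  have hp : (Set.projIcc (0 : ℝ) 1 zero_le_one (x 1) : ℝ) = x 1 := by
    rw [Set.projIcc_of_mem zero_le_one ⟨hx1, by linarith⟩]
  apply Subtype.ext
  funext i
  change x i = ![1 - (Set.projIcc (0 : ℝ) 1 zero_le_one (∑ j : Fin 2, x j • ![(0 : ℝ), 1] j) : ℝ),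
    Set.projIcc (0 : ℝ) 1 zero_le_one (∑ j : Fin 2, x j • ![(0 : ℝ), 1] j)] i
  simp only [Fin.sum_univ_two, Matrix.cons_val_zero, Matrix.cons_val_one, smul_eq_mul, mul_zero,
    mul_one, zero_add, hp]
  fin_cases i
  · simp; linarith
  · simp

end

end

/-! ### Potentials from local contractions. -/

noncomputable section

open CategoryTheory Simplicial Topology

section

variable {Y : Type u} [TopologicalSpace Y] {N : Type u} [AddCommGroup N]

/-- Path classes are differences of a potential as soon as this holds along homotopies which
contract small open sets to points. -/
theorem map_segmentClass_eq_sub (q : (integralChains Y).opcycles 1 →+ N) (a : Y → N)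
    (H : ∀ y, ∃ U : Set Y, IsOpen U ∧ y ∈ U ∧ ∃ K : C(Y × ℝ, Y), (∀ z, K (z, 1) = z) ∧
      (∃ c, ∀ z ∈ U, K (z, 0) = c) ∧
      ∀ z, q (segmentClass (K.comp (ContinuousMap.prodMk (.const ℝ z) (.id ℝ))) 0 1) =
        a z - a (K (z, 0)))
    (φ : C(ℝ, Y)) (s t : ℝ) : q (segmentClass φ s t) = a (φ t) - a (φ s) := by
  -- The relation is symmetric and transitive in `s`, `t`, so by connectedness of `ℝ` it suffices to
  -- prove it for `t` near `s`.
  refine isPreconnected_univ.induction₂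
    (fun s t => q (segmentClass φ s t) = a (φ t) - a (φ s)) ?_ ?_ ?_ (Set.mem_univ s)
    (Set.mem_univ t)
  · intro s _
    obtain ⟨U, hU, hsU, K, hK1, ⟨c, hK0⟩, hKa⟩ := H (φ s)
    obtain ⟨ε, hε, hball⟩ := Metric.isOpen_iff.1 (hU.preimage φ.continuous) s hsU
    rw [nhdsWithin_univ]
    filter_upwards [Metric.ball_mem_nhds s hε] with t ht
    -- `Φ` maps a square whose top side is the path. The top is homologous to the other three sides:
    -- the bottom is constant because `K` contracts `U`, and the vertical sides are tracks of the
    -- homotopy, known by hypothesis.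
    let Φ : C(ℝ × ℝ, Y) := K.comp (ContinuousMap.prodMk (φ.comp .fst) .snd)
    have hΦ : ∀ x r, Φ (x, r) = K (φ x, r) := fun _ _ => rfl
    have e1 : segmentClass φ s t = segmentClass Φ (s, 1) (t, 1) := by
      refine segmentClass_congr fun r _ => ?_
      simp [hΦ, hK1]
    have e2 : segmentClass Φ (s, 0) (t, 0) = 0 := by
      refine segmentClass_eq_zero (y := c) fun r hr => ?_
      have : (1 - r) • s + r • t ∈ Metric.ball s ε :=
        (convex_ball s ε) (Metric.mem_ball_self hε) ht (by linarith [hr.2]) hr.1 (by ring)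
      have := hK0 _ (hball this)
      simpa [hΦ] using this
    have e3 : ∀ x, q (segmentClass Φ (x, 0) (x, 1)) = a (φ x) - a c + (a c - a (K (φ x, 0))) := by
      intro x
      rw [sub_add_sub_cancel, ← hKa]
      congr 1
      refine segmentClass_congr fun r _ => ?_
      have : (1 - r) * x + r * x = x := by ring
      simp [hΦ, this]
    have e4 := segmentClass_add Φ (s, 1) (s, 0) (t, 1)
    have e5 := segmentClass_add Φ (s, 0) (t, 0) (t, 1)
    rw [segmentClass_symm] at e4
    have hs : K (φ s, 0) = c := hK0 _ hsU
    have ht' : K (φ t, 0) = c := hK0 _ (hball ht)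
    rw [e1, ← e4, ← e5, e2, map_add, map_add, map_neg, map_zero, e3, e3, hs, ht']
    abel
  · intro r s t _ _ _ h1 h2
    rw [← segmentClass_add φ r s t, map_add, h1, h2]
    abel
  · intro s t _ _ h
    rw [segmentClass_symm, map_neg, h]
    abel

theorem firstBettiNumber_le_of_segmentClass (q : (integralChains Y).opcycles 1 →+ N) (a : Y → N)
    (H : ∀ φ : C(ℝ, Y), q (segmentClass φ 0 1) = a (φ 1) - a (φ 0))
    {κ : Type} [Fintype κ] (w : κ → (integralChains Y).opcycles 1)
    (hw : ∀ x, q x = 0 → x ∈ AddSubgroup.closure (Set.range w)) :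
    firstBettiNumber Y ≤ Fintype.card κ := by
  let ev : (TopCat.toSSet.obj (TopCat.of Y)) _⦋0⦌ → Y := fun v =>
    TopCat.toSSetObjEquiv (TopCat.of Y) (.op ⦋0⦌) v (default : stdSimplex ℝ (Fin 1))
  have hev : ∀ (φ : C(ℝ, Y)) (b : Fin 1 → ℝ), ev (affineSimplex φ b) = φ (b 0) := by
    intro φ b
    simp only [ev, affineSimplex, Equiv.apply_symm_apply]
    change φ (∑ i : Fin 1, (default : stdSimplex ℝ (Fin 1)) i • b i) = _
    have h1 : (default : stdSimplex ℝ (Fin 1)) 0 = 1 := by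
      have := (default : stdSimplex ℝ (Fin 1)).2.2
      rwa [Fin.sum_univ_one] at this
    rw [Fin.sum_univ_one, h1, one_smul]
  refine firstBettiNumber_le_of_potential q (a ∘ ev) (fun σ => ?_) w hw
  obtain ⟨φ, rfl⟩ := exists_affineSimplex σ
  rw [δ_affineSimplex, δ_affineSimplex, Function.comp_apply, Function.comp_apply, hev, hev]
  exact H φ

end

end

/-! ### Extending a potential from the vertices to a finite graph. -/

noncomputable section

open Topology

section

variable {m n : ℕ} {src tgt : Fin n → Fin m}

/-- A homotopy of the unit interval relative to its end-points, performed on every edge. -/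
def graphHomotopy (src tgt : Fin n → Fin m) (h : C(unitInterval × ℝ, unitInterval))
    (h0 : ∀ s, h (0, s) = 0) (h1 : ∀ s, h (1, s) = 1) :
    C(GraphRealization src tgt × ℝ, GraphRealization src tgt) :=
  ContinuousMap.uncurry
    -- The gluing is done for maps into the function space `C(ℝ, _)`, so that continuity need only
    -- be checked before passing to the quotient; uncurrying is continuous because `ℝ` is locally
    -- compact.
    ⟨Quot.lift
      (Sum.elim (fun v => ContinuousMap.const ℝ (Quot.mk _ (Sum.inl v)))
        (fun p => ⟨fun s => Quot.mk _ (Sum.inr (p.1, h (p.2, s))), by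
          refine continuous_quot_mk.comp (continuous_inr.comp ?_)
          fun_prop⟩))
      (by
        rintro _ _ (e | e)
        · ext s
          simpa [h0] using Quot.sound (EndpointRel.src (src := src) (tgt := tgt) e)
        · ext s
          simpa [h1] using Quot.sound (EndpointRel.tgt (src := src) (tgt := tgt) e)), by
      refine continuous_quot_lift _ ?_
      let F : C((Fin n × unitInterval) × ℝ, GraphRealization src tgt) :=
        ⟨fun p => Quot.mk _ (Sum.inr (p.1.1, h (p.1.2, p.2))), by
          refine continuous_quot_mk.comp (continuous_inr.comp ?_)
          fun_prop⟩
      exact continuous_sum_dom.2 ⟨continuous_of_discreteTopology, F.curry.continuous⟩⟩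

/-- The straight homotopy from `k` to the identity of the unit interval. -/
def straightHomotopy (k : C(unitInterval, unitInterval)) : C(unitInterval × ℝ, unitInterval) :=
  ⟨fun p => Set.projIcc (0 : ℝ) 1 zero_le_one
    ((1 - Set.projIcc (0 : ℝ) 1 zero_le_one p.2) * k p.1 +
      Set.projIcc (0 : ℝ) 1 zero_le_one p.2 * p.1), by fun_prop⟩

theorem coe_straightHomotopy (k : C(unitInterval, unitInterval)) (t : unitInterval) {s : ℝ}
    (hs : s ∈ Set.Icc (0 : ℝ) 1) : (straightHomotopy k (t, s) : ℝ) = (1 - s) * k t + s * t := by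
  have : (1 - s) * (k t : ℝ) + s * t ∈ Set.Icc (0 : ℝ) 1 :=
    (convex_Icc 0 1) (k t).2 t.2 (by linarith [hs.2]) hs.1 (by ring)
  simp only [straightHomotopy, ContinuousMap.coe_mk]
  rw [Set.projIcc_of_mem zero_le_one hs, Set.projIcc_of_mem zero_le_one this]

theorem straightHomotopy_fixed (k : C(unitInterval, unitInterval)) {t : unitInterval}
    (ht : k t = t) (s : ℝ) : straightHomotopy k (t, s) = t := by
  simp only [straightHomotopy, ContinuousMap.coe_mk]
  rw [ht, ← add_mul, sub_add_cancel, one_mul, Set.projIcc_val]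

variable {Y : Type u} [TopologicalSpace Y]

/-- The characteristic map of an edge, constant beyond the end-points. -/
def edgeMap (η : Y ≃ₜ GraphRealization src tgt) (e : Fin n) : C(ℝ, Y) :=
  ⟨fun t => η.symm (Quot.mk _ (Sum.inr (e, Set.projIcc (0 : ℝ) 1 zero_le_one t))), by
    refine η.symm.continuous.comp (continuous_quot_mk.comp (continuous_inr.comp ?_))
    fun_prop⟩

theorem edgeMap_coe (η : Y ≃ₜ GraphRealization src tgt) (e : Fin n) (t : unitInterval) :
    edgeMap η e t = η.symm (Quot.mk _ (Sum.inr (e, t))) := by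
  simp [edgeMap]

/-- The extension of a potential on the vertices to the whole graph. -/
def graphPotential {N : Type u} [AddCommGroup N] (η : Y ≃ₜ GraphRealization src tgt)
    (q : (integralChains Y).opcycles 1 →+ N) (α : Fin m → N)
    (hα : ∀ e, α (tgt e) = α (src e) + q (segmentClass (edgeMap η e) 0 1)) (y : Y) : N :=
  Quot.lift (Sum.elim α (fun p => α (src p.1) + q (segmentClass (edgeMap η p.1) 0 (p.2 : ℝ))))
    (by
      rintro _ _ (e | e)
      · simp [segmentClass_self]
      · simp [hα]) (η y)

/-- Vertices do not move, and a point `t` of an edge is tracked by the segment of that edge from `k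
t` to `t`. The potential was defined by integrating along edges, so additivity of segments gives its
difference. -/
theorem map_segmentClass_graphHomotopy {N : Type u} [AddCommGroup N]
    (η : Y ≃ₜ GraphRealization src tgt) (q : (integralChains Y).opcycles 1 →+ N) (α : Fin m → N)
    (hα : ∀ e, α (tgt e) = α (src e) + q (segmentClass (edgeMap η e) 0 1))
    (k : C(unitInterval, unitInterval)) (hk0 : k 0 = 0) (hk1 : k 1 = 1) :
    ∃ K : C(Y × ℝ, Y), (∀ z, K (z, 1) = z) ∧
      (∀ v, K (η.symm (Quot.mk _ (Sum.inl v)), 0) = η.symm (Quot.mk _ (Sum.inl v))) ∧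
      (∀ e t, K (η.symm (Quot.mk _ (Sum.inr (e, t))), 0) =
        η.symm (Quot.mk _ (Sum.inr (e, k t)))) ∧
      ∀ z, q (segmentClass (K.comp (ContinuousMap.prodMk (.const ℝ z) (.id ℝ))) 0 1) =
        graphPotential η q α hα z - graphPotential η q α hα (K (z, 0)) := by
  let Γ := graphHomotopy src tgt (straightHomotopy k) (straightHomotopy_fixed k hk0)
    (straightHomotopy_fixed k hk1)
  let K : C(Y × ℝ, Y) := ⟨fun p => η.symm (Γ (η p.1, p.2)), by fun_prop⟩
  have hKv : ∀ v s, K (η.symm (Quot.mk _ (Sum.inl v)), s) = η.symm (Quot.mk _ (Sum.inl v)) := by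
    intro v s
    change η.symm (Γ (η (η.symm _), s)) = _
    rw [η.apply_symm_apply]
    rfl
  have hKe : ∀ e t s, K (η.symm (Quot.mk _ (Sum.inr (e, t))), s) =
      edgeMap η e (straightHomotopy k (t, s)) := by
    intro e t s
    change η.symm (Γ (η (η.symm _), s)) = _
    rw [η.apply_symm_apply, edgeMap_coe]
    rfl
  have hs0 : ∀ t, straightHomotopy k (t, 0) = k t := by
    intro t
    apply Subtype.ext
    rw [coe_straightHomotopy k t (by simp)]
    ring
  have hs1 : ∀ t, straightHomotopy k (t, 1) = t := by
    intro t
    apply Subtype.ext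
    rw [coe_straightHomotopy k t (by simp)]
    ring
  have hpot : ∀ e t, graphPotential η q α hα (edgeMap η e ((t : unitInterval) : ℝ)) =
      α (src e) + q (segmentClass (edgeMap η e) 0 (t : ℝ)) := by
    intro e t
    rw [edgeMap_coe, graphPotential, η.apply_symm_apply]
    rfl
  have hcase : ∀ z : Y, (∃ v, z = η.symm (Quot.mk _ (Sum.inl v))) ∨
      ∃ e t, z = η.symm (Quot.mk _ (Sum.inr (e, t))) := by
    intro z
    obtain ⟨(v | ⟨e, t⟩), hx⟩ := Quot.exists_rep (η z)
    · exact Or.inl ⟨v, by rw [hx, η.symm_apply_apply]⟩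
    · exact Or.inr ⟨e, t, by rw [hx, η.symm_apply_apply]⟩
  refine ⟨K, fun z => ?_, fun v => hKv v 0, fun e t => ?_, fun z => ?_⟩
  · rcases hcase z with ⟨v, rfl⟩ | ⟨e, t, rfl⟩
    · exact hKv v 1
    · rw [hKe, hs1, edgeMap_coe]
  · rw [hKe, hs0, edgeMap_coe]
  · rcases hcase z with ⟨v, rfl⟩ | ⟨e, t, rfl⟩
    · rw [hKv, sub_self, segmentClass_eq_zero (fun s _ => hKv v _), map_zero]
    · rw [hKe, hs0, ← edgeMap_coe, hpot, hpot]
      have : segmentClass (K.comp (ContinuousMap.prodMk (.const ℝ (edgeMap η e (t : ℝ))) (.id ℝ))) 0 1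
          = segmentClass (edgeMap η e) (k t : ℝ) (t : ℝ) := by
        refine segmentClass_congr fun s hs => ?_
        have h2 := hKe e t s
        rw [coe_straightHomotopy k t hs] at h2
        simpa [edgeMap_coe] using h2
      rw [this, ← segmentClass_add (edgeMap η e) 0 (k t : ℝ) (t : ℝ), map_add]
      abel

/-- The open set of a graph given by a predicate on its vertices and edges. -/
theorem isOpen_setOf_quotLift (P : Fin m ⊕ (Fin n × unitInterval) → Prop)
    (hP : ∀ x y, EndpointRel src tgt x y → P x = P y)
    (ho : ∀ e, IsOpen {t | P (Sum.inr (e, t))}) :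
    IsOpen {g | Quot.lift (r := EndpointRel src tgt) P hP g} := by
  rw [← isQuotientMap_quot_mk.isOpen_preimage, isOpen_sum_iff]
  refine ⟨isOpen_discrete _, ?_⟩
  have : (Sum.inr ⁻¹' (Quot.mk (EndpointRel src tgt) ⁻¹'
      {g | Quot.lift (r := EndpointRel src tgt) P hP g}) : Set (Fin n × unitInterval)) =
      ⋃ e, (Prod.fst ⁻¹' {e}) ∩ Prod.snd ⁻¹' {t | P (Sum.inr (e, t))} := by
    ext ⟨e, t⟩
    simp
  rw [this]
  exact isOpen_iUnion fun e => ((isOpen_discrete _).preimage continuous_fst).inter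
    ((ho e).preimage continuous_snd)

/-- Open stars of vertices and open middle parts of edges cover the graph. Each is collapsed to a
point by a reparametrization of the edges fixing their ends, which supplies the local contractions.
-/
theorem map_segmentClass_eq_graphPotential_sub {N : Type u} [AddCommGroup N]
    (η : Y ≃ₜ GraphRealization src tgt) (q : (integralChains Y).opcycles 1 →+ N) (α : Fin m → N)
    (hα : ∀ e, α (tgt e) = α (src e) + q (segmentClass (edgeMap η e) 0 1))
    (φ : C(ℝ, Y)) (s t : ℝ) :
    q (segmentClass φ s t) =
      graphPotential η q α hα (φ t) - graphPotential η q α hα (φ s) := by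
  refine map_segmentClass_eq_sub q _ (fun y => ?_) φ s t
  have star : ∀ v : Fin m, ∃ U : Set Y, IsOpen U ∧ η.symm (Quot.mk _ (Sum.inl v)) ∈ U ∧
      (∀ e (t : unitInterval), (t : ℝ) < 1 / 3 → src e = v →
        η.symm (Quot.mk _ (Sum.inr (e, t))) ∈ U) ∧
      (∀ e (t : unitInterval), 2 / 3 < (t : ℝ) → tgt e = v →
        η.symm (Quot.mk _ (Sum.inr (e, t))) ∈ U) ∧
      ∃ K : C(Y × ℝ, Y), (∀ z, K (z, 1) = z) ∧
      (∃ c, ∀ z ∈ U, K (z, 0) = c) ∧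
      ∀ z, q (segmentClass (K.comp (ContinuousMap.prodMk (.const ℝ z) (.id ℝ))) 0 1) =
        graphPotential η q α hα z - graphPotential η q α hα (K (z, 0)) := by
    intro v
    let P : Fin m ⊕ (Fin n × unitInterval) → Prop := Sum.elim (fun w => w = v)
      (fun p => ((p.2 : ℝ) < 1 / 3 ∧ src p.1 = v) ∨ (2 / 3 < (p.2 : ℝ) ∧ tgt p.1 = v))
    have hP : ∀ x y, EndpointRel src tgt x y → P x = P y := by
      rintro _ _ (e | e)
      · simp only [P, Sum.elim_inl, Sum.elim_inr]; norm_num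
      · simp only [P, Sum.elim_inl, Sum.elim_inr]; norm_num
    -- This collapses `[0, 1/3]` to `0` and `[2/3, 1]` to `1`, hence the star of `v` to `v`.
    let k : C(unitInterval, unitInterval) :=
      ⟨fun t => Set.projIcc (0 : ℝ) 1 zero_le_one (3 * t - 1), by fun_prop⟩
    have hk0 : ∀ t : unitInterval, (t : ℝ) < 1 / 3 → k t = 0 := fun t ht =>
      Set.projIcc_of_le_left zero_le_one (by linarith)
    have hk1 : ∀ t : unitInterval, 2 / 3 < (t : ℝ) → k t = 1 := fun t ht =>
      Set.projIcc_of_right_le zero_le_one (by linarith)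
    obtain ⟨K, hK1, hKv, hKe, hK⟩ := map_segmentClass_graphHomotopy η q α hα k
      (hk0 0 (by norm_num)) (hk1 1 (by norm_num))
    refine ⟨η ⁻¹' {g | Quot.lift P hP g}, ?_, ?_, ?_, ?_, K, hK1,
      ⟨η.symm (Quot.mk _ (Sum.inl v)), ?_⟩, hK⟩
    · refine (isOpen_setOf_quotLift P hP fun e => ?_).preimage η.continuous
      have o1 : IsOpen {t : unitInterval | (t : ℝ) < 1 / 3} :=
        isOpen_lt continuous_subtype_val continuous_const
      have o2 : IsOpen {t : unitInterval | 2 / 3 < (t : ℝ)} :=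
        isOpen_lt continuous_const continuous_subtype_val
      exact (o1.inter (isOpen_const (p := src e = v))).union
        (o2.inter (isOpen_const (p := tgt e = v)))
    · simp [P]
    · intro e t ht he
      simp only [Set.mem_preimage, η.apply_symm_apply]
      exact Or.inl ⟨ht, he⟩
    · intro e t ht he
      simp only [Set.mem_preimage, η.apply_symm_apply]
      exact Or.inr ⟨ht, he⟩
    · intro z hz
      obtain ⟨(w | ⟨e, t⟩), hx⟩ := Quot.exists_rep (η z)
      · have hz' : Quot.lift P hP (η z) := hz
        rw [← hx] at hz'
        have hwv : w = v := hz'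
        rw [← η.symm_apply_apply z, ← hx, hKv, hwv]
      · have hz' : Quot.lift P hP (η z) := hz
        rw [← hx] at hz'
        have hz'' : ((t : ℝ) < 1 / 3 ∧ src e = v) ∨ (2 / 3 < (t : ℝ) ∧ tgt e = v) := hz'
        rw [← η.symm_apply_apply z, ← hx, hKe]
        rcases hz'' with ⟨ht, he⟩ | ⟨ht, he⟩
        · rw [hk0 t ht, Quot.sound (EndpointRel.src e), he]
        · rw [hk1 t ht, Quot.sound (EndpointRel.tgt e), he]
  have hmid : ∀ (e : Fin n) (t : unitInterval), 1 / 4 < (t : ℝ) → (t : ℝ) < 3 / 4 →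
      ∃ U : Set Y, IsOpen U ∧ η.symm (Quot.mk _ (Sum.inr (e, t))) ∈ U ∧
      ∃ K : C(Y × ℝ, Y), (∀ z, K (z, 1) = z) ∧
      (∃ c, ∀ z ∈ U, K (z, 0) = c) ∧
      ∀ z, q (segmentClass (K.comp (ContinuousMap.prodMk (.const ℝ z) (.id ℝ))) 0 1) =
        graphPotential η q α hα z - graphPotential η q α hα (K (z, 0)) := by
    intro e t ht1 ht2
    let P : Fin m ⊕ (Fin n × unitInterval) → Prop := Sum.elim (fun w => False)
      (fun p => (1 / 4 < (p.2 : ℝ) ∧ (p.2 : ℝ) < 3 / 4) ∧ p.1 = e)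
    have hP : ∀ x y, EndpointRel src tgt x y → P x = P y := by
      rintro _ _ (e | e)
      · simp only [P, Sum.elim_inl, Sum.elim_inr]; norm_num
      · simp only [P, Sum.elim_inl, Sum.elim_inr]; norm_num
    -- This collapses `[1/4, 3/4]` to `1/2` and has slope `2` on either side; the overlap with the
    -- stars of radius `1/3` ensures that nothing is left uncovered.
    let k : C(unitInterval, unitInterval) :=
      ⟨fun t => Set.projIcc (0 : ℝ) 1 zero_le_one (min (2 * t) (max (1 / 2) (2 * t - 1))),
        by fun_prop⟩
    have hk : ∀ t : unitInterval, 1 / 4 < (t : ℝ) → (t : ℝ) < 3 / 4 →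
        k t = Set.projIcc (0 : ℝ) 1 zero_le_one (1 / 2) := by
      intro t h1 h2
      simp only [k, ContinuousMap.coe_mk]
      rw [max_eq_left (by linarith), min_eq_right (by linarith)]
    obtain ⟨K, hK1, hKv, hKe, hK⟩ := map_segmentClass_graphHomotopy η q α hα k
      (by simp [k]) (by simp only [k, ContinuousMap.coe_mk]; norm_num)
    refine ⟨η ⁻¹' {g | Quot.lift P hP g}, ?_, ?_, K, hK1,
      ⟨η.symm (Quot.mk _ (Sum.inr (e, Set.projIcc (0 : ℝ) 1 zero_le_one (1 / 2)))), ?_⟩, hK⟩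
    · refine (isOpen_setOf_quotLift P hP fun e' => ?_).preimage η.continuous
      have o1 : IsOpen {t : unitInterval | 1 / 4 < (t : ℝ)} :=
        isOpen_lt continuous_const continuous_subtype_val
      have o2 : IsOpen {t : unitInterval | (t : ℝ) < 3 / 4} :=
        isOpen_lt continuous_subtype_val continuous_const
      exact (o1.inter o2).inter (isOpen_const (p := e' = e))
    · simp only [Set.mem_preimage, η.apply_symm_apply]
      exact ⟨⟨ht1, ht2⟩, rfl⟩
    · intro z hz
      obtain ⟨(w | ⟨e', t⟩), hx⟩ := Quot.exists_rep (η z)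
      · have hz' : Quot.lift P hP (η z) := hz
        rw [← hx] at hz'
        exact hz'.elim
      · have hz' : Quot.lift P hP (η z) := hz
        rw [← hx] at hz'
        obtain ⟨⟨h1, h2⟩, rfl⟩ : (1 / 4 < (t : ℝ) ∧ (t : ℝ) < 3 / 4) ∧ e' = e := hz'
        rw [← η.symm_apply_apply z, ← hx, hKe, hk t h1 h2]
  obtain ⟨(v | ⟨e, t⟩), hx⟩ := Quot.exists_rep (η y)
  · obtain ⟨U, hU, hv, -, -, hK⟩ := star v
    rw [hx, η.symm_apply_apply] at hv
    exact ⟨U, hU, hv, hK⟩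
  · rcases lt_or_ge (t : ℝ) (1 / 3) with ht | ht
    · obtain ⟨U, hU, -, hs, -, hK⟩ := star (src e)
      have hy := hs e t ht rfl
      rw [hx, η.symm_apply_apply] at hy
      exact ⟨U, hU, hy, hK⟩
    · rcases lt_or_ge (2 / 3) (t : ℝ) with ht' | ht'
      · obtain ⟨U, hU, -, -, hs, hK⟩ := star (tgt e)
        have hy := hs e t ht' rfl
        rw [hx, η.symm_apply_apply] at hy
        exact ⟨U, hU, hy, hK⟩
      · obtain ⟨U, hU, hy, hK⟩ := hmid e t (by linarith) (by linarith)
        rw [hx, η.symm_apply_apply] at hy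
        exact ⟨U, hU, hy, hK⟩

end

end

/-! ### Spanning trees and the bound on the Betti number. -/

noncomputable section

open Topology

section

variable {m n : ℕ} {src tgt : Fin n → Fin m}

/-- Two vertices are adjacent in the subgraph with edge set `T`. -/
def EdgeAdj (src tgt : Fin n → Fin m) (T : Finset (Fin n)) (u v : Fin m) : Prop :=
  ∃ e ∈ T, src e = u ∧ tgt e = v

/-- Every edge labelling of the subgraph with edge set `T` is a difference of vertex labels. This
says that `T` is a forest. -/
def IsForestEdgeSet (src tgt : Fin n → Fin m) (T : Finset (Fin n)) : Prop :=
  ∀ (A : Type u) [AddCommGroup A] (w : Fin n → A),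
    ∃ α : Fin m → A, ∀ e ∈ T, α (tgt e) = α (src e) + w e

/-- The new edge joins two different components of the old forest. Shifting all labels on the
component of its target by one constant corrects the new edge and leaves the old differences
unchanged. -/
theorem IsForestEdgeSet.insert {T : Finset (Fin n)} (hT : IsForestEdgeSet.{u} src tgt T) {e : Fin n}
    (he : ¬ Relation.EqvGen (EdgeAdj src tgt T) (src e) (tgt e)) :
    IsForestEdgeSet.{u} src tgt (insert e T) := by
  classical
  intro A _ w
  obtain ⟨α, hα⟩ := hT A w
  refine ⟨fun v => if Relation.EqvGen (EdgeAdj src tgt T) (tgt e) v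
    then α v + (α (src e) + w e - α (tgt e)) else α v, fun e' he' => ?_⟩
  rcases Finset.mem_insert.1 he' with rfl | h
  · beta_reduce
    rw [if_pos (Relation.EqvGen.refl _), if_neg (fun h => he (h.symm _ _))]
    abel
  · have hadj : Relation.EqvGen (EdgeAdj src tgt T) (src e') (tgt e') :=
      Relation.EqvGen.rel _ _ ⟨e', h, rfl, rfl⟩
    have hiff : Relation.EqvGen (EdgeAdj src tgt T) (tgt e) (tgt e') ↔
        Relation.EqvGen (EdgeAdj src tgt T) (tgt e) (src e') :=
      ⟨fun h => h.trans _ _ _ (hadj.symm _ _), fun h => h.trans _ _ _ hadj⟩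
    by_cases h1 : Relation.EqvGen (EdgeAdj src tgt T) (tgt e) (src e')
    · simp only [if_pos h1, if_pos (hiff.2 h1), hα e' h]
      abel
    · simp only [if_neg h1, if_neg (fun h => h1 (hiff.1 h)), hα e' h]

/-- If the realization of a graph is connected, an equivalence relation on the vertices which
relates the end-points of every edge is trivial. -/
theorem eqvGen_of_connected [ConnectedSpace (GraphRealization src tgt)] {r : Fin m → Fin m → Prop}
    (hr : ∀ e, Relation.EqvGen r (src e) (tgt e)) (u v : Fin m) : Relation.EqvGen r u v := by
  let s := Relation.EqvGen.setoid r
  let : TopologicalSpace (Quotient s) := ⊥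
  have : DiscreteTopology (Quotient s) := ⟨rfl⟩
  let F : GraphRealization src tgt → Quotient s :=
    Quot.lift (Sum.elim (fun v => Quotient.mk s v) (fun p => Quotient.mk s (src p.1))) (by
      rintro _ _ (e | e)
      · rfl
      · exact Quotient.sound (hr e))
  have hF : Continuous F := by
    refine continuous_quot_lift _ (continuous_sum_dom.2 ⟨continuous_of_discreteTopology, ?_⟩)
    exact (continuous_of_discreteTopology (f := fun e => Quotient.mk s (src e))).comp continuous_fst
  exact Quotient.exact (PreconnectedSpace.constant inferInstance hF
    (x := Quot.mk _ (Sum.inl u)) (y := Quot.mk _ (Sum.inl v)))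

/-- A maximal forest spans: an edge with ends in different components could be added to it, so all
edges have their ends in one component, and connectedness leaves a single component. -/
theorem exists_spanning_isForestEdgeSet [ConnectedSpace (GraphRealization src tgt)] :
    ∃ T : Finset (Fin n), IsForestEdgeSet.{u} src tgt T ∧
      ∀ u v, Relation.EqvGen (EdgeAdj src tgt T) u v := by
  classical
  have h0 : IsForestEdgeSet.{u} src tgt ∅ := fun A _ w => ⟨0, by simp⟩
  obtain ⟨T, hT⟩ := (Set.toFinite {T : Finset (Fin n) | IsForestEdgeSet.{u} src tgt T}).exists_maximal
    ⟨∅, h0⟩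
  refine ⟨T, hT.prop, eqvGen_of_connected (src := src) (tgt := tgt) fun e => ?_⟩
  by_contra he
  have hle := hT.le_of_ge (IsForestEdgeSet.insert hT.prop he) (Finset.subset_insert e T)
  exact he (Relation.EqvGen.rel _ _ ⟨e, hle (Finset.mem_insert_self e T), rfl, rfl⟩)

/-- The elements `w` are the defects of the edges outside `T`. Modulo the subgroup they generate,
the labels that fit the forest fit every edge. -/
theorem firstBettiNumber_le_card_compl {Y : Type u} [TopologicalSpace Y]
    (η : Y ≃ₜ GraphRealization src tgt) {T : Finset (Fin n)} (hT : IsForestEdgeSet.{u} src tgt T) :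
    firstBettiNumber Y ≤ Fintype.card {e : Fin n // e ∉ T} := by
  obtain ⟨α, hα⟩ := hT ((integralChains Y).opcycles 1)
    (fun e => segmentClass (edgeMap η e) 0 1)
  let w : {e : Fin n // e ∉ T} → (integralChains Y).opcycles 1 := fun e =>
    α (src e) + segmentClass (edgeMap η e) 0 1 - α (tgt e)
  let q := QuotientAddGroup.mk' (AddSubgroup.closure (Set.range w))
  have hq : ∀ e, q (α (tgt e)) = q (α (src e)) + q (segmentClass (edgeMap η e) 0 1) := by
    intro e
    rw [← map_add]
    by_cases he : e ∈ T
    · rw [hα e he]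
    · symm
      rw [← sub_eq_zero, ← map_sub]
      exact (QuotientAddGroup.eq_zero_iff _).2 (AddSubgroup.subset_closure ⟨⟨e, he⟩, rfl⟩)
  refine firstBettiNumber_le_of_segmentClass q (graphPotential η q (q ∘ α) hq)
    (fun φ => map_segmentClass_eq_graphPotential_sub η q (q ∘ α) hq φ 0 1) w
    (fun x hx => (QuotientAddGroup.eq_zero_iff _).1 hx)

end

end

/-! ### Bridge covers and free quotients of the fundamental group. -/

noncomputable section

open Topology

section

variable {X : Type u} [TopologicalSpace X] {ι : Type u}

/-- A decomposition of a space modelled on the complement of the mid-points of some edges of a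
graph: the space is covered by a `core` and disjoint `bridge`s, and every bridge meets the core in
two disjoint open sets. -/
structure BridgeCover (X : Type u) [TopologicalSpace X] (ι : Type u) where
  core : Set X
  bridge : ι → Set X
  left : ι → Set X
  right : ι → Set X
  isOpen_left : ∀ i, IsOpen (left i)
  isOpen_right : ∀ i, IsOpen (right i)
  isPathConnected_core : IsPathConnected core
  isPathConnected_bridge : ∀ i, IsPathConnected (bridge i)
  isOpen_core : IsOpen core
  isOpen_bridge : ∀ i, IsOpen (bridge i)
  left_nonempty : ∀ i, (left i).Nonempty
  right_nonempty : ∀ i, (right i).Nonempty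
  disjoint_left_right : ∀ i, Disjoint (left i) (right i)
  core_inter_bridge : ∀ i, core ∩ bridge i = left i ∪ right i
  disjoint_bridge : ∀ i j, i ≠ j → Disjoint (bridge i) (bridge j)
  cover : ∀ x, x ∈ core ∨ ∃ i, x ∈ bridge i

namespace BridgeCover

variable (D : BridgeCover X ι)

/-- The members of the cover. -/
def piece : Option ι → Set X
  | none => D.core
  | some i => D.bridge i

open Classical in
/-- The transition function from the core to the members of the cover. -/
def transition (j : Option ι) (x : X) : FreeGroup ι :=
  match j with
  | none => 1
  | some i => if x ∈ D.right i then FreeGroup.of i else 1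

open Classical in
/-- A member of the cover containing the given point. -/
def index (x : X) : Option ι :=
  if h : x ∈ D.core then none else some ((D.cover x).resolve_left h).choose

theorem index_of_mem_core {x : X} (h : x ∈ D.core) : D.index x = none := by
  simp [index, h]

theorem mem_piece_index (x : X) : x ∈ D.piece (D.index x) := by
  unfold index
  split_ifs with h
  · exact h
  · exact ((D.cover x).resolve_left h).choose_spec

theorem isOpen_piece (j : Option ι) : IsOpen (D.piece j) := by
  cases j
  · exact D.isOpen_core
  · exact D.isOpen_bridge _

theorem eventually_transition_some (i : ι) {x : X} (hx : x ∈ D.core ∩ D.bridge i) :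
    ∀ᶠ y in 𝓝 x, D.transition (some i) y = D.transition (some i) x := by
  rw [D.core_inter_bridge] at hx
  rcases hx with hx | hx
  · filter_upwards [(D.isOpen_left i).mem_nhds hx] with y hy
    simp [transition, (D.disjoint_left_right i).notMem_of_mem_left hy,
      (D.disjoint_left_right i).notMem_of_mem_left hx]
  · filter_upwards [(D.isOpen_right i).mem_nhds hx] with y hy
    simp [transition, hx, hy]

/-- A single `transition` jumps inside its bridge, but only its behaviour on overlaps matters.
Distinct bridges are disjoint, so the only proper overlaps are between the core and a bridge, where
the left and right parts are open and disjoint. -/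
theorem eventually_transition (j k : Option ι) {x : X} (hx : x ∈ D.piece j ∩ D.piece k) :
    ∀ᶠ y in 𝓝 x, D.transition k y * (D.transition j y)⁻¹ =
      D.transition k x * (D.transition j x)⁻¹ := by
  rcases j with _ | j <;> rcases k with _ | k
  · simp
  · filter_upwards [D.eventually_transition_some k hx] with y hy
    rw [hy]; rfl
  · filter_upwards [D.eventually_transition_some j hx.symm] with y hy
    rw [hy]; rfl
  · by_cases h : j = k
    · subst h
      simp
    · exact ((D.disjoint_bridge j k h).notMem_of_mem_left hx.1 hx.2).elim

/-- The discrete topology on the fibre of the free covering. -/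
abbrev fibreTopology (ι : Type u) : TopologicalSpace (FreeGroup ι) := ⊥

attribute [local instance] fibreTopology

theorem discreteTopology_fibre (ι : Type u) : DiscreteTopology (FreeGroup ι) := ⟨rfl⟩

attribute [local instance] discreteTopology_fibre

/-- The covering with fibre the free group in which crossing a bridge is multiplication by the
corresponding generator. -/
def freeCovering : FiberBundleCore (Option ι) X (FreeGroup ι) where
  baseSet := D.piece
  isOpen_baseSet := D.isOpen_piece
  indexAt := D.index
  mem_baseSet_at := D.mem_piece_index
  coordChange j k x g := D.transition k x * (D.transition j x)⁻¹ * g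
  coordChange_self j x _ g := by simp
  continuousOn_coordChange j k := by
    rintro ⟨x, g⟩ ⟨hx, -⟩
    refine ContinuousAt.continuousWithinAt ?_
    have h1 : ∀ᶠ p : X × FreeGroup ι in 𝓝 (x, g), D.transition k p.1 * (D.transition j p.1)⁻¹ =
        D.transition k x * (D.transition j x)⁻¹ :=
      continuousAt_fst.eventually (D.eventually_transition j k hx)
    have h2 : ∀ᶠ p : X × FreeGroup ι in 𝓝 (x, g), p.2 = g :=
      
      (continuousAt_snd (p := (x, g))).preimage_mem_nhds (t := {g}) ((isOpen_discrete _).mem_nhds rfl)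
    refine Filter.EventuallyEq.continuousAt (y := D.transition k x * (D.transition j x)⁻¹ * g) ?_
    filter_upwards [h1, h2] with p hp1 hp2
    rw [hp1, hp2]
  coordChange_comp i j k x _ g := by group

theorem isCoveringMap_proj : IsCoveringMap (Bundle.TotalSpace.proj (F := FreeGroup ι)
    (E := D.freeCovering.Fiber)) :=
  FiberBundle.isCoveringMap

/-- The right translations of the fibres. -/
def translate (h : FreeGroup ι) (p : D.freeCovering.TotalSpace) : D.freeCovering.TotalSpace :=
  ⟨p.1, (show FreeGroup ι from p.2) * h⟩

/-- Changes of chart multiply on the left and so commute with right translation, which in every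
chart is right multiplication on the discrete fibre. -/
theorem continuous_translate (h : FreeGroup ι) : Continuous (D.translate h) := by
  rw [continuous_iff_continuousAt]
  intro p
  rw [FiberBundle.continuousAt_totalSpace]
  have hid := (FiberBundle.continuousAt_totalSpace (F := FreeGroup ι)
    (fun p : D.freeCovering.TotalSpace => p) (x₀ := p)).1 continuousAt_id
  refine ⟨hid.1, ?_⟩
  have h2 := (continuous_of_discreteTopology (f := fun g : FreeGroup ι => g * h)).continuousAt.comp
    hid.2
  refine h2.congr (Filter.Eventually.of_forall fun r => ?_)
  exact mul_assoc (D.transition (D.index p.1) r.1 * (D.transition (D.index r.1) r.1)⁻¹)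
    (show FreeGroup ι from r.2) h

/-- The local section of the covering over a member of the cover. -/
def sectionAt (j : Option ι) (g : FreeGroup ι) (x : X) : D.freeCovering.TotalSpace :=
  -- The point with constant coordinate `g` in the chart `j`, rewritten in the preferred chart at
  -- `x`.
  ⟨x, (show FreeGroup ι from D.transition (D.index x) x * (D.transition j x)⁻¹ * g)⟩

theorem continuousOn_sectionAt (j : Option ι) (g : FreeGroup ι) :
    ContinuousOn (D.sectionAt j g) (D.piece j) := by
  have h := (D.freeCovering.localTriv j).continuousOn_invFun
  have h2 : ContinuousOn (fun x : X => (x, g)) (D.piece j) := by fun_prop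
  exact (h.comp h2 (fun x hx => (D.freeCovering.mem_localTriv_target j _).2 hx)).congr
    fun x hx => (D.freeCovering.localTriv_symm_apply j (x, g)).symm

theorem joined_sectionAt (j : Option ι) (g : FreeGroup ι) {x y : X} (hx : x ∈ D.piece j)
    (hy : y ∈ D.piece j) : Joined (D.sectionAt j g x) (D.sectionAt j g y) := by
  have hp : IsPathConnected (D.piece j) := by
    cases j
    · exact D.isPathConnected_core
    · exact D.isPathConnected_bridge _
  exact ((hp.image' (D.continuousOn_sectionAt j g)).joinedIn _ ⟨x, hx, rfl⟩ _ ⟨y, hy, rfl⟩).joined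

/-- Go through the core to the left end of the bridge, cross to the right end, and return through
the core. The transition is `1` on the left and the generator on the right, so the round trip
removes one generator. -/
theorem joined_generator {x₀ : X} (hx₀ : x₀ ∈ D.core) (i : ι) (g : FreeGroup ι) :
    Joined (D.sectionAt none (FreeGroup.of i * g) x₀) (D.sectionAt none g x₀) := by
  obtain ⟨l, hl⟩ := D.left_nonempty i
  obtain ⟨r, hr⟩ := D.right_nonempty i
  have hl' : l ∈ D.core ∩ D.bridge i := by rw [D.core_inter_bridge]; exact Or.inl hl
  have hr' : r ∈ D.core ∩ D.bridge i := by rw [D.core_inter_bridge]; exact Or.inr hr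
  have hlr : l ∉ D.right i := (D.disjoint_left_right i).notMem_of_mem_left hl
  have e1 : D.sectionAt none (FreeGroup.of i * g) l = D.sectionAt (some i) (FreeGroup.of i * g) l := by
    simp [sectionAt, transition, hlr]
  have e2 : D.sectionAt none g r = D.sectionAt (some i) (FreeGroup.of i * g) r := by
    simp [sectionAt, transition, hr, mul_assoc]
  have j1 := D.joined_sectionAt none (FreeGroup.of i * g) hx₀ hl'.1
  have j2 := D.joined_sectionAt (some i) (FreeGroup.of i * g) hl'.2 hr'.2
  have j3 := D.joined_sectionAt none g hr'.1 hx₀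
  rw [e1] at j1
  rw [e2] at j3
  exact j1.trans (j2.trans j3)

theorem joined_fibre {x₀ : X} (hx₀ : x₀ ∈ D.core) (g h : FreeGroup ι) :
    Joined (D.sectionAt none (g * h) x₀) (D.sectionAt none h x₀) := by
  induction g using FreeGroup.induction_on generalizing h with
  | C1 => rw [one_mul]
  | of i => exact D.joined_generator hx₀ i h
  | inv_of i _ =>
    have := D.joined_generator hx₀ i ((FreeGroup.of i)⁻¹ * h)
    rw [mul_inv_cancel_left] at this
    exact this.symm
  | mul a b ha hb =>
    rw [mul_assoc]
    exact (ha (b * h)).trans (hb h)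

theorem sectionAt_none {x₀ : X} (hx₀ : x₀ ∈ D.core) (g : FreeGroup ι) :
    D.sectionAt none g x₀ = ⟨x₀, g⟩ := by
  simp only [sectionAt, D.index_of_mem_core hx₀, transition, inv_one, one_mul, mul_one]

/-- The fundamental group of a space with a bridge cover maps onto the free group on the set of
bridges. -/
theorem exists_surjective {x₀ : X} (hx₀ : x₀ ∈ D.core) :
    ∃ φ : FundamentalGroup X x₀ →* FreeGroup ι, Function.Surjective φ := by
  let p : D.freeCovering.TotalSpace → X := Bundle.TotalSpace.proj
  have cov : IsCoveringMap p := D.isCoveringMap_proj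
  let P := cov.monodromyPerm x₀
  let pt : FreeGroup ι → p ⁻¹' {x₀} := fun g => ⟨⟨x₀, g⟩, rfl⟩
  have hpt : ∀ z : p ⁻¹' {x₀}, ∃ g, z = pt g := by
    rintro ⟨⟨x, g⟩, hx⟩
    obtain rfl : x = x₀ := hx
    exact ⟨g, rfl⟩
  have hinj : Function.Injective pt := by
    intro g h hgh
    have := congrArg Subtype.val hgh
    exact eq_of_heq (Bundle.TotalSpace.mk.inj this).2
  choose coord hcoord using hpt
  have hcp : ∀ g, coord (pt g) = g := fun g => (hinj (hcoord (pt g))).symm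
  -- Monodromy commutes with right translations, so it acts on the fibre by left multiplication by
  -- the image of `1`; this makes `γ ↦ coord (P γ (pt 1))` multiplicative.
  have hequiv : ∀ (γ : FundamentalGroup X x₀) (g h : FreeGroup ι),
      P γ (pt (g * h)) = pt (coord (P γ (pt g)) * h) := by
    intro γ g h
    have hz := hcoord (P γ (pt g))
    set k := coord (P γ (pt g))
    obtain ⟨Γ⟩ := γ
    have e1 : (cov.liftPath Γ (⟨x₀, g⟩ : D.freeCovering.TotalSpace) Γ.source) 1 = ⟨x₀, k⟩ :=
      congrArg Subtype.val hz
    apply Subtype.ext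
    change (cov.liftPath Γ (⟨x₀, g * h⟩ : D.freeCovering.TotalSpace) Γ.source) 1 = ⟨x₀, k * h⟩
    -- By uniqueness of lifts, the translate of a lift is the lift from the translated starting
    -- point.
    have e2 : (D.translate h ∘ cov.liftPath Γ (⟨x₀, g⟩ : D.freeCovering.TotalSpace) Γ.source) =
        cov.liftPath Γ (⟨x₀, g * h⟩ : D.freeCovering.TotalSpace) Γ.source := by
      rw [cov.eq_liftPath_iff]
      refine ⟨(D.continuous_translate h).comp (ContinuousMap.continuous _),
        cov.liftPath_lifts Γ (⟨x₀, g⟩ : D.freeCovering.TotalSpace) Γ.source, ?_⟩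
      rw [Function.comp_apply, cov.liftPath_zero]
      rfl
    rw [← e2, Function.comp_apply, e1]
    rfl
  refine ⟨⟨⟨fun γ => coord (P γ (pt 1)), ?_⟩, ?_⟩, fun g => ?_⟩
  · rw [map_one, Equiv.Perm.one_apply, hcp]
  · intro γ δ
    change coord (P (γ * δ) (pt 1)) = coord (P γ (pt 1)) * coord (P δ (pt 1))
    rw [map_mul, Equiv.Perm.mul_apply, hcoord (P δ (pt 1)), hcp]
    have := hequiv γ 1 (coord (P δ (pt 1)))
    rw [one_mul] at this
    rw [this, hcp]
  -- A path upstairs from `1` to `g` projects to a loop whose monodromy carries `1` to `g`.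
  · have hj := (D.joined_fibre hx₀ g 1).symm
    rw [mul_one, D.sectionAt_none hx₀, D.sectionAt_none hx₀] at hj
    obtain ⟨Γ⟩ := hj
    refine ⟨Path.Homotopic.Quotient.map (.mk Γ) ⟨p, cov.continuous⟩, ?_⟩
    change coord (P _ (pt 1)) = g
    have := cov.monodromy_map (.mk Γ)
    exact (congrArg coord this).trans (hcp g)

end BridgeCover

end

end

/-! ### Cutting the graph at mid-points and pulling the pieces back. -/

noncomputable section

open Topology

section

/-- Over an open set the map is still a quotient map. A clopen set upstairs is a union of connected
fibres, so it descends to a clopen set of the base. -/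
theorem isConnected_preimage_of_isQuotientMap {X Z : Type*} [TopologicalSpace X]
    [TopologicalSpace Z] {f : X → Z} (hf : IsQuotientMap f)
    (hfib : ∀ z, IsConnected (f ⁻¹' {z})) {U : Set Z} (hU : IsOpen U) (hc : IsConnected U) :
    IsConnected (f ⁻¹' U) := by
  have : ConnectedSpace U := isConnected_iff_connectedSpace.1 hc
  have hq := hf.restrictPreimage_isOpen hU
  have h1 : ∀ u : U, IsConnected (U.restrictPreimage f ⁻¹' {u}) := by
    intro u
    have himg : Subtype.val '' (U.restrictPreimage f ⁻¹' {u}) = f ⁻¹' {u.1} := by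
      ext x
      constructor
      · rintro ⟨y, hy, rfl⟩
        exact congrArg Subtype.val hy
      · intro hx
        have hx' : f x = u := hx
        exact ⟨⟨x, by rw [Set.mem_preimage, hx']; exact u.2⟩, Subtype.ext hx', rfl⟩
    have := hfib u.1
    rw [← himg] at this
    exact ⟨Set.image_nonempty.1 this.1, IsInducing.subtypeVal.isPreconnected_image.1 this.2⟩
  have h2 := hq.isCoinducing.isConnected_preimage_of_isClosed h1 isClosed_univ isConnected_univ
  rw [Set.preimage_univ] at h2
  exact isConnected_iff_connectedSpace.2 (connectedSpace_iff_univ.2 h2)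

variable {m n : ℕ} (src tgt : Fin n → Fin m)

/-- The part of an edge parametrized by a set of real numbers. -/
def edgeArc (e : Fin n) (s : Set ℝ) : Set (GraphRealization src tgt) :=
  (fun t : ℝ => Quot.mk _ (Sum.inr (e, Set.projIcc (0 : ℝ) 1 zero_le_one t))) '' s

theorem isConnected_edgeArc (e : Fin n) {s : Set ℝ} (hs : IsConnected s) :
    IsConnected (edgeArc src tgt e s) := by
  refine hs.image _ (Continuous.continuousOn ?_)
  refine continuous_quot_mk.comp (continuous_inr.comp ?_)
  fun_prop

variable {src tgt}

theorem mk_mem_edgeArc {e : Fin n} {s : Set ℝ} {t : unitInterval} (ht : (t : ℝ) ∈ s) :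
    (Quot.mk _ (Sum.inr (e, t)) : GraphRealization src tgt) ∈ edgeArc src tgt e s :=
  ⟨t, ht, by simp⟩

theorem edgeArc_subset_iff {e : Fin n} {s : Set ℝ} (hs : s ⊆ Set.Icc 0 1)
    {A : Set (GraphRealization src tgt)} :
    edgeArc src tgt e s ⊆ A ↔
      ∀ t : unitInterval, (t : ℝ) ∈ s → (Quot.mk _ (Sum.inr (e, t))) ∈ A := by
  constructor
  · exact fun h t ht => h (mk_mem_edgeArc ht)
  · rintro h _ ⟨t, ht, rfl⟩
    refine h _ ?_
    rwa [Set.projIcc_of_mem zero_le_one (hs ht)]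

variable (src tgt)

/-- The open arc of an edge, for an open interval inside the unit interval. -/
theorem isOpen_edgeArc (e : Fin n) {a b : ℝ} (ha : 0 ≤ a) (hb : b ≤ 1) :
    IsOpen (edgeArc src tgt e (Set.Ioo a b)) := by
  let P : Fin m ⊕ (Fin n × unitInterval) → Prop := Sum.elim (fun _ => False)
    (fun p => (p.2 : ℝ) ∈ Set.Ioo a b ∧ p.1 = e)
  have hP : ∀ x y, EndpointRel src tgt x y → P x = P y := by
    rintro _ _ (e | e)
    · simp [P, ha.not_gt]
    · simp [P, hb.not_gt]
  have : edgeArc src tgt e (Set.Ioo a b) = {g | Quot.lift (r := EndpointRel src tgt) P hP g} := by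
    refine Set.Subset.antisymm ((edgeArc_subset_iff
      (Set.Ioo_subset_Icc_self.trans (Set.Icc_subset_Icc ha hb))).2 fun t ht => ⟨ht, rfl⟩) ?_
    rintro ⟨v | ⟨e', t⟩⟩ h
    · exact False.elim h
    · obtain ⟨ht, rfl⟩ : (t : ℝ) ∈ Set.Ioo a b ∧ e' = e := h
      exact mk_mem_edgeArc ht
  rw [this]
  refine isOpen_setOf_quotLift P hP fun e' => ?_
  have o1 : IsOpen {t : unitInterval | (t : ℝ) ∈ Set.Ioo a b} :=
    isOpen_Ioo.preimage continuous_subtype_val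
  exact o1.inter (isOpen_const (p := e' = e))

theorem mk_mem_edgeArc_iff {e e' : Fin n} {a b : ℝ} (ha : 0 ≤ a) (hb : b ≤ 1) {t : unitInterval} :
    (Quot.mk _ (Sum.inr (e', t)) : GraphRealization src tgt) ∈ edgeArc src tgt e (Set.Ioo a b) ↔
      e' = e ∧ (t : ℝ) ∈ Set.Ioo a b := by
  constructor
  · rintro ⟨s, hs, hst⟩
    -- `P` is false at the vertices and at both ends of every edge, so it respects the gluing and
    -- can be read off from a point of the quotient.
    let P : Fin m ⊕ (Fin n × unitInterval) → Prop := Sum.elim (fun _ => False)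
      (fun p => p.1 = e ∧ (p.2 : ℝ) ∈ Set.Ioo a b)
    have hP : ∀ x y, EndpointRel src tgt x y → P x = P y := by
      rintro _ _ (e | e)
      · simp [P, ha.not_gt]
      · simp [P, hb.not_gt]
    have h := congrArg (Quot.lift P hP) hst
    change P _ = P _ at h
    refine h.mp ⟨rfl, ?_⟩
    change (Set.projIcc (0 : ℝ) 1 zero_le_one s : ℝ) ∈ _
    rwa [Set.projIcc_of_mem zero_le_one ⟨ha.trans hs.1.le, hs.2.le.trans hb⟩]
  · rintro ⟨rfl, ht⟩
    exact mk_mem_edgeArc ht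

theorem vertex_notMem_edgeArc {e : Fin n} {a b : ℝ} (ha : 0 ≤ a) (hb : b ≤ 1) (v : Fin m) :
    (Quot.mk _ (Sum.inl v) : GraphRealization src tgt) ∉ edgeArc src tgt e (Set.Ioo a b) := by
  rintro ⟨s, hs, hst⟩
  let P : Fin m ⊕ (Fin n × unitInterval) → Prop := Sum.elim (fun _ => False)
    (fun p => (p.2 : ℝ) ∈ Set.Ioo a b)
  have hP : ∀ x y, EndpointRel src tgt x y → P x = P y := by
    rintro _ _ (e | e)
    · simp [P, ha.not_gt]
    · simp [P, hb.not_gt]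
  have h := congrArg (Quot.lift P hP) hst
  change P _ = P _ at h
  refine h.mp ?_
  change (Set.projIcc (0 : ℝ) 1 zero_le_one s : ℝ) ∈ _
  rwa [Set.projIcc_of_mem zero_le_one ⟨ha.trans hs.1.le, hs.2.le.trans hb⟩]

/-- The realization of a graph without the mid-points of the edges outside of `T`. -/
def cutGraph (T : Finset (Fin n)) : Set (GraphRealization src tgt) :=
  {g | Quot.lift (r := EndpointRel src tgt)
    (Sum.elim (fun _ => True) (fun p => p.1 ∈ T ∨ (p.2 : ℝ) ≠ 1 / 2))
    (by
      rintro _ _ (e | e)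
      · simp
      · simp only [Sum.elim_inl, Sum.elim_inr]; norm_num) g}

theorem isOpen_cutGraph (T : Finset (Fin n)) : IsOpen (cutGraph src tgt T) := by
  refine isOpen_setOf_quotLift _ _ fun e => ?_
  have o1 : IsOpen {t : unitInterval | (t : ℝ) ≠ 1 / 2} :=
    isOpen_ne_fun continuous_subtype_val continuous_const
  exact (isOpen_const (p := e ∈ T)).union o1

variable {src tgt}

theorem vertex_mem_cutGraph (T : Finset (Fin n)) (v : Fin m) :
    Quot.mk _ (Sum.inl v) ∈ cutGraph src tgt T :=
  trivial

theorem mk_mem_cutGraph_iff {T : Finset (Fin n)} {e : Fin n} {t : unitInterval} :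
    Quot.mk _ (Sum.inr (e, t)) ∈ cutGraph src tgt T ↔ e ∈ T ∨ (t : ℝ) ≠ 1 / 2 :=
  Iff.rfl

/-- A point slides to an end of its edge without crossing a removed mid-point, and the vertices are
linked by the edges of `T`, which are intact. -/
theorem isConnected_cutGraph {T : Finset (Fin n)}
    (hT : ∀ u v, Relation.EqvGen (EdgeAdj src tgt T) u v) (v₀ : Fin m) :
    IsConnected (cutGraph src tgt T) := by
  let cc := connectedComponentIn (cutGraph src tgt T)
  have harc : ∀ (e : Fin n) (s : Set ℝ), IsConnected s → s ⊆ Set.Icc 0 1 →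
      (e ∈ T ∨ (1 / 2 : ℝ) ∉ s) → ∀ t t' : unitInterval, (t : ℝ) ∈ s → (t' : ℝ) ∈ s →
      cc (Quot.mk _ (Sum.inr (e, t))) = cc (Quot.mk _ (Sum.inr (e, t'))) := by
    intro e s hs hs1 he t t' ht ht'
    refine connectedComponentIn_eq
      ((isConnected_edgeArc src tgt e hs).isPreconnected.subset_connectedComponentIn
        (mk_mem_edgeArc ht) ((edgeArc_subset_iff hs1).2 fun r hr => ?_) (mk_mem_edgeArc ht'))
    rcases he with he | he
    · exact Or.inl he
    · exact Or.inr fun h => he (h ▸ hr)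
  have hsrc : ∀ e, (Quot.mk _ (Sum.inr (e, 0)) : GraphRealization src tgt) =
      Quot.mk _ (Sum.inl (src e)) := fun e => Quot.sound (EndpointRel.src e)
  have htgt : ∀ e, (Quot.mk _ (Sum.inr (e, 1)) : GraphRealization src tgt) =
      Quot.mk _ (Sum.inl (tgt e)) := fun e => Quot.sound (EndpointRel.tgt e)
  have hI : IsConnected (Set.Icc (0 : ℝ) 1) := isConnected_Icc zero_le_one
  have hvert : ∀ u v, Relation.EqvGen (EdgeAdj src tgt T) u v →
      cc (Quot.mk _ (Sum.inl u)) = cc (Quot.mk _ (Sum.inl v)) := by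
    intro u v h
    induction h with
    | rel u v h =>
      obtain ⟨e, he, rfl, rfl⟩ := h
      rw [← hsrc, ← htgt]
      exact harc e _ hI subset_rfl (Or.inl he) 0 1 (by simp) (by simp)
    | refl => rfl
    | symm _ _ _ ih => exact ih.symm
    | trans _ _ _ _ _ h1 h2 => exact h1.trans h2
  have hall : ∀ g ∈ cutGraph src tgt T, ∃ v, cc g = cc (Quot.mk _ (Sum.inl v)) := by
    rintro ⟨v | ⟨e, t⟩⟩ hg
    · exact ⟨v, rfl⟩
    · rcases mk_mem_cutGraph_iff.1 hg with he | ht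
      · refine ⟨src e, ?_⟩
        rw [← hsrc]
        exact harc e _ hI subset_rfl (Or.inl he) t 0 t.2 (by simp)
      · rcases lt_or_gt_of_ne ht with ht | ht
        · refine ⟨src e, ?_⟩
          rw [← hsrc]
          exact harc e (Set.Ico 0 (1 / 2)) (isConnected_Ico (by norm_num))
            (fun x hx => ⟨hx.1, by linarith [hx.2]⟩) (Or.inr (by simp)) t 0 ⟨t.2.1, ht⟩ (by simp)
        · refine ⟨tgt e, ?_⟩
          rw [← htgt]
          exact harc e (Set.Ioc (1 / 2) 1) (isConnected_Ioc (by norm_num))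
            (fun x hx => ⟨by linarith [hx.1], hx.2⟩) (Or.inr (by simp)) t 1 ⟨ht, t.2.2⟩
            (by simp; norm_num)
  have heq : cutGraph src tgt T = cc (Quot.mk _ (Sum.inl v₀)) := by
    refine Set.Subset.antisymm (fun g hg => ?_) (connectedComponentIn_subset _ _)
    obtain ⟨v, hv⟩ := hall g hg
    rw [← hvert v v₀ (hT v v₀), ← hv]
    exact mem_connectedComponentIn hg
  refine ⟨⟨_, vertex_mem_cutGraph T v₀⟩, ?_⟩
  rw [heq]
  exact isPreconnected_connectedComponentIn

/-- The bridge cover induced by a map to a graph with connected fibres and by a spanning set of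
edges. -/
def graphBridgeCover {X : Type u} [TopologicalSpace X] [LocallyPathConnectedSpace X]
    {p : X → GraphRealization src tgt} (hp : IsQuotientMap p)
    (hfib : ∀ z, IsConnected (p ⁻¹' {z})) {T : Finset (Fin n)}
    (hT : ∀ u v, Relation.EqvGen (EdgeAdj src tgt T) u v) (v₀ : Fin m) :
    BridgeCover X (ULift.{u} {e : Fin n // e ∉ T}) :=
  -- Connectedness of the preimage comes from the fibres; local path-connectedness of `X` upgrades
  -- it to path-connectedness.
  have hpath : ∀ U : Set (GraphRealization src tgt), IsOpen U → IsConnected U →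
      IsPathConnected (p ⁻¹' U) := fun U hU hc =>
    (hU.preimage hp.continuous).isConnected_iff_isPathConnected.1
      (isConnected_preimage_of_isQuotientMap hp hfib hU hc)
  { core := p ⁻¹' cutGraph src tgt T
    bridge := fun e => p ⁻¹' edgeArc src tgt e.down.1 (Set.Ioo 0 1)
    left := fun e => p ⁻¹' edgeArc src tgt e.down.1 (Set.Ioo 0 (1 / 2))
    right := fun e => p ⁻¹' edgeArc src tgt e.down.1 (Set.Ioo (1 / 2) 1)
    isOpen_left := fun e => (isOpen_edgeArc src tgt _ le_rfl (by norm_num)).preimage hp.continuous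
    isOpen_right := fun e => (isOpen_edgeArc src tgt _ (by norm_num) le_rfl).preimage hp.continuous
    isPathConnected_core := hpath _ (isOpen_cutGraph src tgt T) (isConnected_cutGraph hT v₀)
    isPathConnected_bridge := fun e => hpath _ (isOpen_edgeArc src tgt _ le_rfl le_rfl)
      (isConnected_edgeArc src tgt _ (isConnected_Ioo zero_lt_one))
    isOpen_core := (isOpen_cutGraph src tgt T).preimage hp.continuous
    isOpen_bridge := fun e => (isOpen_edgeArc src tgt _ le_rfl le_rfl).preimage hp.continuous
    left_nonempty := fun e => ((Set.nonempty_Ioo.2 (by norm_num)).image _).preimage hp.surjective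
    right_nonempty := fun e => ((Set.nonempty_Ioo.2 (by norm_num)).image _).preimage hp.surjective
    disjoint_left_right := fun e => by
      refine Disjoint.preimage p (Set.disjoint_left.2 ?_)
      rintro ⟨v | ⟨e', t⟩⟩ h1 h2
      · exact vertex_notMem_edgeArc src tgt le_rfl (by norm_num) v h1
      · have h1' := ((mk_mem_edgeArc_iff src tgt le_rfl (by norm_num)).1 h1).2
        have h2' := ((mk_mem_edgeArc_iff src tgt (by norm_num) le_rfl).1 h2).2
        exact lt_asymm h1'.2 h2'.1
    core_inter_bridge := fun e => by
      rw [← Set.preimage_inter, ← Set.preimage_union]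
      congr 1
      ext g
      obtain ⟨v | ⟨e', t⟩⟩ := g
      · refine iff_of_false (fun h => vertex_notMem_edgeArc src tgt le_rfl le_rfl v h.2) ?_
        rintro (h | h)
        · exact vertex_notMem_edgeArc src tgt le_rfl (by norm_num) v h
        · exact vertex_notMem_edgeArc src tgt (by norm_num) le_rfl v h
      · refine (and_congr mk_mem_cutGraph_iff (mk_mem_edgeArc_iff src tgt le_rfl le_rfl)).trans
          (Iff.trans ?_ (or_congr (mk_mem_edgeArc_iff src tgt le_rfl (by norm_num))
            (mk_mem_edgeArc_iff src tgt (by norm_num) le_rfl)).symm)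
        constructor
        · rintro ⟨h | h, rfl, ht⟩
          · exact (e.down.2 h).elim
          · rcases lt_or_gt_of_ne h with h | h
            · exact Or.inl ⟨rfl, ht.1, h⟩
            · exact Or.inr ⟨rfl, h, ht.2⟩
        · rintro (⟨rfl, ht⟩ | ⟨rfl, ht⟩)
          · exact ⟨Or.inr ht.2.ne, rfl, ht.1, ht.2.trans (by norm_num)⟩
          · exact ⟨Or.inr ht.1.ne', rfl, lt_trans (by norm_num) ht.1, ht.2⟩
    disjoint_bridge := fun e e' hne => by
      refine Disjoint.preimage p (Set.disjoint_left.2 ?_)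
      rintro ⟨v | ⟨e'', t⟩⟩ h1 h2
      · exact vertex_notMem_edgeArc src tgt le_rfl le_rfl v h1
      · have h1' := ((mk_mem_edgeArc_iff src tgt le_rfl le_rfl).1 h1).1
        have h2' := ((mk_mem_edgeArc_iff src tgt le_rfl le_rfl).1 h2).1
        exact hne (ULift.ext _ _ (Subtype.ext (h1'.symm.trans h2')))
    cover := fun x => by
      have : ∀ g : GraphRealization src tgt, g ∈ cutGraph src tgt T ∨
          ∃ e : ULift.{u} {e : Fin n // e ∉ T}, g ∈ edgeArc src tgt e.down.1 (Set.Ioo 0 1) := by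
        rintro ⟨v | ⟨e, t⟩⟩
        · exact Or.inl (vertex_mem_cutGraph T v)
        · by_cases he : e ∈ T
          · exact Or.inl (Or.inl he)
          · by_cases ht : (t : ℝ) = 1 / 2
            · exact Or.inr ⟨⟨e, he⟩, mk_mem_edgeArc (by rw [ht]; norm_num)⟩
            · exact Or.inl (Or.inr ht)
      exact this (p x) }

theorem isConnected_preimage_reebGraph_mk {X : Type*} [TopologicalSpace X] (f : X → ℝ)
    (z : ReebGraph f) : IsConnected ((Quotient.mk (contourSetoid f) : X → ReebGraph f) ⁻¹' {z}) := by
  obtain ⟨x, rfl⟩ := Quotient.exists_rep z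
  have : (Quotient.mk (contourSetoid f) : X → ReebGraph f) ⁻¹' {Quotient.mk (contourSetoid f) x} =
      connectedComponentIn (f ⁻¹' {f x}) x := by
    ext y
    exact Quotient.eq.trans ⟨fun h => (contourSetoid f).symm h, fun h => (contourSetoid f).symm h⟩
  exact (congrArg IsConnected this).mpr (isConnected_connectedComponentIn_iff.2 rfl)

end

end

/-! ### Combining the two bounds. -/

theorem theorem3p1 {X : Type u} [TopologicalSpace X] [ConnectedSpace X] [LocallyPathConnectedSpace X]
    (f : X → ℝ) (hf : Continuous f) (hR : IsFiniteTopologicalGraph (ReebGraph f)) (x₀ : X) :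
    firstBettiNumber (ReebGraph f) ≤ corank (FundamentalGroup X x₀) := by
  obtain ⟨m, n, src, tgt, ⟨η⟩⟩ := hR
  let p : X → GraphRealization src tgt := fun x => η (Quotient.mk (contourSetoid f) x)
  have hp : Topology.IsQuotientMap p := η.isQuotientMap.comp isQuotientMap_quotient_mk'
  have hfib : ∀ z, IsConnected (p ⁻¹' {z}) := by
    intro z
    have : p ⁻¹' {z} =
        (Quotient.mk (contourSetoid f) : X → ReebGraph f) ⁻¹' {η.symm z} := by
      ext x
      exact η.toEquiv.eq_symm_apply.symm
    rw [this]
    exact isConnected_preimage_reebGraph_mk f _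
  have : ConnectedSpace (GraphRealization src tgt) := hp.surjective.connectedSpace hp.continuous
  obtain ⟨T, hT, hspan⟩ := exists_spanning_isForestEdgeSet.{u} (src := src) (tgt := tgt)
  have hv : Nonempty (Fin m) := by
    obtain ⟨v | ⟨e, -⟩, -⟩ := Quot.exists_rep (p x₀)
    · exact ⟨v⟩
    · exact ⟨src e⟩
  let D := graphBridgeCover hp hfib hspan hv.some
  -- The base point `x₀` may lie over a removed mid-point, so the surjection is built at a point of
  -- the core and transported.
  obtain ⟨x₁, hx₁⟩ := D.isPathConnected_core.nonempty
  obtain ⟨φ, hφ⟩ := D.exists_surjective hx₁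
  have : PathConnectedSpace X := pathConnectedSpace_iff_connectedSpace.2 inferInstance
  let ψ := FundamentalGroup.fundamentalGroupMulEquivOfPathConnected x₀ x₁
  refine (firstBettiNumber_le_card_compl η hT).trans (le_csSup (bddAbove_freeImageRanks _)
    ⟨ULift.{u} {e : Fin n // e ∉ T}, φ.comp ψ.toMonoidHom, hφ.comp ψ.surjective, ?_⟩)
  simp
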